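/- Conventions. Let $\mathbb{E}_1$ be the equivalence relation on $(2^{\mathbb{N}})^{\mathbb{N}}$ given by $x \mathrel{\mathbb{E}_1} y \iff \exists n \in \mathbb{N}\ \forall m \ge n\ x(m) = y(m)$. A *reduction* of an equivalence relation $E$ on $X$ to an equivalence relation $F$ on $Y$ is a function $\phi \colon X \to Y$ with $x \mathrel{E} x' \iff \phi(x) \mathrel{F} \phi(x')$ for all $x, x' \in X$; an *embedding* is an injective reduction. $E$ is *Borel reducible* to $F$ if there is a Borel reduction of $E$ to $F$. Write $E{\restriction}A$ for the restriction of $E$ to $A \subseteq X$; subsets of Polish spaces carry the subspace topology and the inherited Borel structure. A function is *Baire measurable* if preimages of open sets have the Baire property. For a class $\mathscr{E}$ of Borel equivalence relations on Polish spaces, a relation is *essentially $\mathscr{E}$* if it is Borel reducible to a relation in $\mathscr{E}$; it is *essentially countable* if this holds where $\mathscr{E}$ is the class of Borel equivalence relations on Polish spaces all of whose classes are countable. For a Borel equivalence relation $E$ on a Polish space $X$, *embeddability of $\mathbb{E}_1$ is determined below $E$ by essentially $\mathscr{E}$* if for every analytic set $A \subseteq X$, either $E{\restriction}A$ is essentially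 $\mathscr{E}$ or there is a continuous embedding of $\mathbb{E}_1$ into $E{\restriction}A$. **Proposition.** 1. Suppose that $X$ and $Y$ are Polish spaces, $E$ and $F$ are Borel equivalence relations on $X$ and $Y$, $A \subseteq X$ is analytic, and $\phi \colon A \to Y$ is a Borel reduction of $E{\restriction}A$ to $F$ for which there is a Baire measurable reduction $\psi \colon (2^{\mathbb{N}})^{\mathbb{N}} \to \phi[A]$ of $\mathbb{E}_1$ to $F{\restriction}\phi[A]$. Then there is a continuous embedding of $\mathbb{E}_1$ into $E{\restriction}A$. 2. For every class $\mathscr{E}$ of Borel equivalence relations on Polish spaces, the class of Borel equivalence relations on Polish spaces below which embeddability of $\mathbb{E}_1$ is determined by essentially $\mathscr{E}$ is closed under Borel reducibility: if $E$ is Borel reducible to $F$ and $F$ belongs to the class, then so does $E$. 3. In particular, the class of Borel equivalence relations on Polish spaces below which embeddability of $\mathbb{E}_1$ is determined by essential countability is closed under Borel reducibility. -/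

import Mathlib

universe u v w

namespace EOneClosure

/-- The space `(2^ℕ)^ℕ` with the product topology (`Bool` is discrete). -/
abbrev CantorSeq : Type := ℕ → ℕ → Bool

/-- The relation `𝔼₁` on `(2^ℕ)^ℕ`: eventual equality of sequences of points of Cantor space. -/
def EOne : Setoid CantorSeq where
  r x y := ∃ n : ℕ, ∀ m, n ≤ m → x m = y m
  iseqv :=
    { refl := fun _ => ⟨0, fun _ _ => rfl⟩
      symm := fun ⟨n, h⟩ => ⟨n, fun m hm => (h m hm).symm⟩
      trans := fun ⟨n, h⟩ ⟨k, h'⟩ => ⟨max n k, fun m hm =>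
        (h m (le_trans (le_max_left n k) hm)).trans (h' m (le_trans (le_max_right n k) hm))⟩ }

/-- The restriction `E ↾ A` of an equivalence relation to a subset, as a relation on the
subtype of elements of `A`. -/
def restrict {X : Type u} (E : Setoid X) (A : Set X) : Setoid A :=
  E.comap Subtype.val

/-- `f` is a reduction of `E` to `F`: it sends related pairs to related pairs and unrelated
pairs to unrelated pairs. -/
def IsReduction {X : Type u} {Y : Type v} (E : Setoid X) (F : Setoid Y) (f : X → Y) : Prop :=
  ∀ x x' : X, E x x' ↔ F (f x) (f x')

/-- `E` is Borel as a subset of `X × X`. -/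
def IsBorelRel {X : Type u} [MeasurableSpace X] (E : Setoid X) : Prop :=
  MeasurableSet {p : X × X | E p.1 p.2}

/-- `f` is Baire measurable: preimages of open sets have the Baire property. -/
def BaireMeasurable {X : Type u} {Y : Type v} [TopologicalSpace X] [TopologicalSpace Y]
    (f : X → Y) : Prop :=
  ∀ V : Set Y, IsOpen V → BaireMeasurableSet (f ⁻¹' V)

/-- There is a continuous embedding (injective reduction) of `𝔼₁` into `E`. -/
def EOneEmbedsContinuously {X : Type u} [TopologicalSpace X] (E : Setoid X) : Prop :=
  ∃ f : CantorSeq → X, Continuous f ∧ Function.Injective f ∧ IsReduction EOne E f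

/-- There is a Borel reduction of `E` to `F`. It is also used for relations on arbitrary subsets
of Polish spaces, which carry the inherited Borel structure. -/
def BorelReducible {X : Type u} {Y : Type v} [MeasurableSpace X] [MeasurableSpace Y]
    (E : Setoid X) (F : Setoid Y) : Prop :=
  ∃ f : X → Y, Measurable f ∧ IsReduction E F f

/-- A Borel equivalence relation on a Polish space. -/
structure BorelEqRel : Type (u + 1) where
  carrier : Type u
  [top : TopologicalSpace carrier]
  [polish : PolishSpace carrier]
  [meas : MeasurableSpace carrier]
  [borel : BorelSpace carrier]
  rel : Setoid carrier
  isBorel : IsBorelRel rel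

attribute [instance] BorelEqRel.top BorelEqRel.polish BorelEqRel.meas BorelEqRel.borel

/-- `E` is essentially `𝓔`: it is Borel reducible to a Borel equivalence relation in `𝓔`. -/
def Essentially {X : Type u} [MeasurableSpace X] (𝓔 : Set BorelEqRel.{w}) (E : Setoid X) : Prop :=
  ∃ R ∈ 𝓔, BorelReducible E R.rel

/-- The class of Borel equivalence relations `E` below which embeddability of `𝔼₁` is determined
by essentially `𝓔`: for every analytic subset `A` of the underlying space, either `E ↾ A` is
essentially `𝓔` or there is a continuous embedding of `𝔼₁` into `E ↾ A`. -/
def determinedClass (𝓔 : Set BorelEqRel.{w}) : Set BorelEqRel.{u} :=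
  {E | ∀ A : Set E.carrier, MeasureTheory.AnalyticSet A →
    Essentially 𝓔 (restrict E.rel A) ∨ EOneEmbedsContinuously (restrict E.rel A)}

/-- The class of countable Borel equivalence relations: all equivalence classes are countable. -/
def countableClass : Set BorelEqRel.{w} :=
  {R | ∀ x : R.carrier, {y | R.rel x y}.Countable}

end EOneClosure

/-!
The first assertion carries the proposition; the other two follow from it, since the image of an
analytic set under a Borel reduction is analytic and a continuous embedding is Baire measurable.

*Lifting.* Let `φ` be a Borel reduction defined on the analytic set `A`, and `ψ` a Baire measurable
reduction of `𝔼₁` into its range. The map `ψ` is continuous on a comeager set, over which the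
relation `φ a = ψ x` is the continuous image of a Borel set. Choosing such an `a` as a continuous
function of `x` on a comeager set amounts to finding a section, on a comeager set, of a continuous
map from Baire space (`exists_continuousOn_section`): assign to each cylinder the open set in which
its image is everywhere nonmeager; off a meager set, the leftmost branch through the open sets
containing `x` is a preimage of `x` and depends continuously on `x`. The result is a map `f` into
`A` which on a comeager set is continuous and a reduction of `𝔼₁` to `E ↾ A`
(`exists_continuousOn_lift`).

*Making `f` injective.* It remains to compose `f` with a continuous reduction `g` of `𝔼₁` to itself
whose range lies in a comeager set `D` and on whose range `f` is injective. As `f` is a reduction,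
only points `x ≠ y` which are equal from some coordinate on need attention. The key lemma
`exists_box_forall_exists_ne` says that in some box, any two points which are equal from a large
`m` on can be approximated by two such points of `D` with different values under `f`. Instead of a
theorem of Kuratowski–Ulam type, it uses that `D` may be taken invariant under the countable group
of finite bit changes.

*Fusion.* The map `g` is the limit of finite approximations in which coordinate `i` of the value
depends only on the coordinates of `x` with index at least `i - k`; this makes `g` a homomorphism
of `𝔼₁`. At every stage finitely many bits of coordinate `i` of `x` are recorded in coordinate
`i + k` of the value, which makes `g` a reduction, and the finitely many pairs of points
distinguished so far are sent into an open set of pairs given by the key lemma. Two distinguished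
points `x` and `y` are forced to share exactly the coordinates of the values from some `m ≥ k` on,
so that the key lemma applies.
-/

open Set Filter Topology TopologicalSpace

namespace EOneClosure

/-! ### Sections of continuous maps on comeager sets -/

/-- The union of the basic open sets in which `A` is meager. -/
def meagerPart {K : Type*} [TopologicalSpace K] [SecondCountableTopology K] (A : Set K) : Set K :=
  ⋃ U ∈ {U | U ∈ countableBasis K ∧ IsMeagre (U ∩ A)}, U

/-- The largest open set in every nonempty open subset of which `A` is nonmeager. -/
def heavyPart {K : Type*} [TopologicalSpace K] [SecondCountableTopology K] (A : Set K) : Set K :=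
  interior (meagerPart A)ᶜ

section Heavy

variable {K : Type*} [TopologicalSpace K] [SecondCountableTopology K]

theorem isOpen_meagerPart (A : Set K) : IsOpen (meagerPart A) :=
  isOpen_biUnion fun _ hU => isOpen_of_mem_countableBasis hU.1

theorem isMeagre_meagerPart_inter (A : Set K) : IsMeagre (meagerPart A ∩ A) := by
  unfold meagerPart
  rw [iUnion₂_inter]
  exact isMeagre_biUnion ((countable_countableBasis K).mono fun _ h => h.1) fun _ hU => hU.2

theorem subset_meagerPart {A U : Set K} (hU : IsOpen U) (h : IsMeagre (U ∩ A)) :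
    U ⊆ meagerPart A := by
  intro x hx
  obtain ⟨V, hV, hxV, hVU⟩ := (isBasis_countableBasis K).exists_subset_of_mem_open hx hU
  exact mem_biUnion (x := V) ⟨hV, h.mono (inter_subset_inter_left _ hVU)⟩ hxV

theorem isMeagre_diff_heavyPart (A : Set K) : IsMeagre (A \ heavyPart A) := by
  have h1 : IsNowhereDense (frontier (meagerPart A)ᶜ) :=
    isClosed_frontier.isNowhereDense_iff.2 (interior_frontier (isOpen_meagerPart A).isClosed_compl)
  refine ((isMeagre_meagerPart_inter A).union h1.isMeagre).mono ?_
  rintro x ⟨hxA, hx⟩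
  by_cases h : x ∈ meagerPart A
  · exact Or.inl ⟨h, hxA⟩
  · exact Or.inr ⟨subset_closure h, hx⟩

theorem heavyPart_iUnion_subset (A : ℕ → Set K) :
    heavyPart (⋃ n, A n) ⊆ closure (⋃ n, heavyPart (A n)) := by
  have h1 : (closure (⋃ n, heavyPart (A n)))ᶜ ⊆ meagerPart (⋃ n, A n) := by
    refine subset_meagerPart isClosed_closure.isOpen_compl ?_
    refine (isMeagre_iUnion fun n => isMeagre_diff_heavyPart (A n)).mono ?_
    rintro x ⟨hx, hxA⟩
    obtain ⟨n, hn⟩ := mem_iUnion.1 hxA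
    exact mem_iUnion.2 ⟨n, hn, fun h => hx (subset_closure (mem_iUnion.2 ⟨n, h⟩))⟩
  intro x hx
  by_contra h
  exact interior_subset hx (h1 h)

theorem heavyPart_subset_closure (A : Set K) : heavyPart A ⊆ closure A := by
  intro x hx
  by_contra h
  refine interior_subset hx (subset_meagerPart isClosed_closure.isOpen_compl ?_ h)
  refine IsMeagre.empty.mono ?_
  rintro y ⟨hy, hyA⟩
  exact hy (subset_closure hyA)

theorem heavyPart_eq_univ [BaireSpace K] {A : Set K} (hA : A ∈ residual K) :
    heavyPart A = univ := by
  have h1 : IsMeagre (meagerPart A) := by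
    have h2 : IsMeagre Aᶜ := by rwa [IsMeagre, compl_compl]
    refine ((isMeagre_meagerPart_inter A).union h2).mono fun x hx => ?_
    by_cases h : x ∈ A
    · exact Or.inl ⟨hx, h⟩
    · exact Or.inr h
  have h2 : meagerPart A = ∅ := by
    by_contra h
    exact not_isMeagre_of_isOpen (isOpen_meagerPart A) (nonempty_iff_ne_empty.2 h) h1
  simp [heavyPart, h2]

end Heavy

/-- The cylinder of all sequences with initial segment `s`. -/
def listCylinder (s : List ℕ) : Set (ℕ → ℕ) :=
  {z | (List.range s.length).map z = s}

theorem listCylinder_eq_iUnion (s : List ℕ) :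
    listCylinder s = ⋃ n, listCylinder (s ++ [n]) := by
  ext z
  simp [listCylinder, List.range_succ]

/-- The finite sequence of length `n` obtained from the empty one by repeatedly extending `s` by the
number `e s`. -/
def followBranch (e : List ℕ → ℕ) : ℕ → List ℕ
  | 0 => []
  | n + 1 => followBranch e n ++ [e (followBranch e n)]

theorem followBranch_eq_map (e : List ℕ → ℕ) (n : ℕ) :
    followBranch e n = (List.range n).map fun m => e (followBranch e m) := by
  induction n with
  | zero => rfl
  | succ n ih => rw [List.range_succ, List.map_append, ← ih]; rfl

theorem frontier_compl_mem_residual {K : Type*} [TopologicalSpace K] {U : Set K} (hU : IsOpen U) :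
    (frontier U)ᶜ ∈ residual K :=
  (isClosed_frontier.isNowhereDense_iff.2
    (frontier_compl U ▸ interior_frontier hU.isClosed_compl)).isMeagre

/-- In a tree of open sets in which the children of every node are dense in the node, the leftmost
branch through the nodes containing a given point is defined, and depends continuously on the
point, on a comeager set. -/
theorem exists_continuousOn_branch {K : Type*} [TopologicalSpace K] (V : List ℕ → Set K)
    (hVo : ∀ s, IsOpen (V s)) (hV0 : V [] = univ)
    (hVsub : ∀ s, V s ⊆ closure (⋃ n, V (s ++ [n]))) :
    ∃ C ∈ residual K, ∃ t : K → (ℕ → ℕ), ContinuousOn t C ∧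
      ∀ x ∈ C, ∀ n, x ∈ V ((List.range n).map (t x)) := by
  let C : Set K := ⋂ s : List ℕ, ((frontier (V s))ᶜ ∩ (frontier (⋃ n, V (s ++ [n])))ᶜ)
  have hCres : C ∈ residual K := countable_iInter_mem.2 fun s =>
    inter_mem (frontier_compl_mem_residual (hVo s))
      (frontier_compl_mem_residual (isOpen_iUnion fun n => hVo _))
  have hext : ∀ x ∈ C, ∀ s, x ∈ V s → ∃ n, x ∈ V (s ++ [n]) := by
    intro x hx s hs
    by_contra h
    refine (mem_iInter.1 hx s).2 ⟨hVsub s hs, fun h' => h ?_⟩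
    exact mem_iUnion.1 (interior_subset h')
  -- the least extension of `s` into which `x` falls
  obtain ⟨e, he⟩ : ∃ e : List ℕ → K → ℕ, ∀ s x, e s x = sInf {n | x ∈ V (s ++ [n])} :=
    ⟨_, fun _ _ => rfl⟩
  obtain ⟨b, b_zero, b_succ, b_map⟩ : ∃ b : ℕ → K → List ℕ, (∀ x, b 0 x = []) ∧
      (∀ n x, b (n + 1) x = b n x ++ [e (b n x) x]) ∧
      ∀ n x, b n x = (List.range n).map fun m => e (b m x) x :=
    ⟨fun n x => followBranch (fun s => e s x) n, fun _ => rfl, fun _ _ => rfl,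
      fun n x => followBranch_eq_map _ n⟩
  have e_mem : ∀ s x, (∃ n, x ∈ V (s ++ [n])) → x ∈ V (s ++ [e s x]) := by
    intro s x h
    rw [he]
    exact Nat.sInf_mem (s := {n | x ∈ V (s ++ [n])}) h
  have e_le : ∀ s x n, x ∈ V (s ++ [n]) → e s x ≤ n := by
    intro s x n h
    rw [he]
    exact Nat.sInf_le h
  have b_mem : ∀ x ∈ C, ∀ n, x ∈ V (b n x) := by
    intro x hx n
    induction n with
    | zero => rw [b_zero, hV0]; trivial
    | succ n ih => rw [b_succ]; exact e_mem _ _ (hext x hx _ ih)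
  have b_cont : ∀ n, ∀ x ∈ C, ∀ᶠ y in 𝓝[C] x, b n y = b n x := by
    intro n x hx
    induction n with
    | zero => exact Eventually.of_forall fun _ => by rw [b_zero, b_zero]
    | succ n ih =>
      have hin : ∀ᶠ y in 𝓝[C] x, y ∈ V (b n x ++ [e (b n x) x]) :=
        nhdsWithin_le_nhds ((hVo _).mem_nhds (e_mem _ _ (hext x hx _ (b_mem x hx n))))
      have hout : ∀ᶠ y in 𝓝[C] x, ∀ m < e (b n x) x, y ∉ V (b n x ++ [m]) := by
        refine nhdsWithin_le_nhds ((eventually_all_finite (finite_lt_nat _)).2 fun m hm => ?_)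
        have h1 : x ∉ V (b n x ++ [m]) := fun h => not_lt_of_ge (e_le _ _ _ h) hm
        have h2 : x ∉ closure (V (b n x ++ [m])) := fun h =>
          (mem_iInter.1 hx (b n x ++ [m])).1 ⟨h, fun h' => h1 (interior_subset h')⟩
        filter_upwards [isClosed_closure.isOpen_compl.mem_nhds h2] with y hy h
        exact hy (subset_closure h)
      filter_upwards [ih, hin, hout] with y h1 h2 h3
      have h4 : e (b n x) y = e (b n x) x := by
        refine le_antisymm (e_le _ _ _ h2) ?_
        by_contra hlt
        exact h3 _ (not_le.1 hlt) (e_mem _ _ ⟨_, h2⟩)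
      rw [b_succ, b_succ, h1, h4]
  refine ⟨C, hCres, fun x n => e (b n x) x, ?_, fun x hx n => ?_⟩
  · intro x hx
    rw [ContinuousWithinAt, tendsto_pi_nhds]
    intro n
    refine tendsto_nhds_of_eventually_eq ?_
    filter_upwards [b_cont (n + 1) x hx] with y hy
    rw [b_succ, b_succ] at hy
    simpa using List.append_inj_right' hy rfl
  · rw [← b_map]
    exact b_mem x hx n

/-- A continuous map from Baire space with comeager range has a section which is defined and
continuous on a comeager set. The section follows the leftmost branch through the open sets in
which the images of cylinders are heavy, so no measurable uniformization theorem is needed. -/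
theorem exists_continuousOn_section {K : Type*} [TopologicalSpace K] [SecondCountableTopology K]
    [BaireSpace K] [T2Space K] (p : (ℕ → ℕ) → K) (hp : Continuous p) (hr : range p ∈ residual K) :
    ∃ C ∈ residual K, ∃ t : K → (ℕ → ℕ), ContinuousOn t C ∧ ∀ x ∈ C, p (t x) = x := by
  obtain ⟨C, hC, t, ht, hmem⟩ := exists_continuousOn_branch
    (fun s => heavyPart (p '' listCylinder s)) (fun s => isOpen_interior)
    (heavyPart_eq_univ (by simpa [listCylinder, image_univ] using hr))
    (fun s => by
      have := heavyPart_iUnion_subset (fun n => p '' listCylinder (s ++ [n]))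
      rwa [← image_iUnion, ← listCylinder_eq_iUnion] at this)
  refine ⟨C, hC, t, ht, fun x hx => ?_⟩
  by_contra hne
  obtain ⟨u, v, hu, hv, h1, h2, hd⟩ := t2_separation hne
  obtain ⟨_, ⟨y, n, rfl⟩, hty, hn⟩ :=
    (PiNat.isTopologicalBasis_cylinders (fun _ : ℕ => ℕ)).exists_subset_of_mem_open
      (show t x ∈ p ⁻¹' u from h1) (hu.preimage hp)
  rw [← PiNat.mem_cylinder_iff_eq.1 hty] at hn
  obtain ⟨w, hwv, hw⟩ := mem_closure_iff.1 (heavyPart_subset_closure _ (hmem x hx n)) v hv h2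
  refine hd.le_bot ⟨?_, hwv⟩
  obtain ⟨z, hz, rfl⟩ := hw
  refine hn ((PiNat.mem_cylinder_iff).2 fun i hi => ?_)
  have h3 : (List.range n).map z = (List.range n).map (t x) := by
    simpa [listCylinder] using hz
  exact List.map_inj_left.1 h3 i (List.mem_range.2 hi)

/-! ### Lifting Baire measurable maps -/

theorem BaireMeasurable.exists_continuousOn {K Z : Type*} [TopologicalSpace K] [TopologicalSpace Z]
    [SecondCountableTopology Z] {ψ : K → Z} (hψ : BaireMeasurable ψ) :
    ∃ C ∈ residual K, ContinuousOn ψ C := by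
  choose O hO hOeq using fun B : countableBasis Z =>
    (hψ B (isOpen_of_mem_countableBasis B.2)).residualEq_isOpen
  have : Countable (countableBasis Z) := (countable_countableBasis Z).to_subtype
  refine ⟨{x | ∀ B : countableBasis Z, x ∈ ψ ⁻¹' (B : Set Z) ↔ x ∈ O B}, ?_, ?_⟩
  · exact eventually_countable_forall.2 fun B => (hOeq B).mem_iff
  · intro x hx
    refine ((isBasis_countableBasis Z).nhds_hasBasis.tendsto_right_iff).2 fun B hB => ?_
    have hxO : x ∈ O ⟨B, hB.1⟩ := (hx ⟨B, hB.1⟩).1 hB.2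
    filter_upwards [self_mem_nhdsWithin, nhdsWithin_le_nhds ((hO ⟨B, hB.1⟩).mem_nhds hxO)]
      with y hy hyO
    exact (hy ⟨B, hB.1⟩).2 hyO

/-- A Baire measurable map into the range of a Borel map `φ` on an analytic set `A` agrees on a
comeager set with `φ ∘ f` for some `f` whose restriction to that set is continuous. -/
theorem exists_continuousOn_lift {K : Type*} {X : Type u} {Y : Type v}
    [TopologicalSpace K] [PolishSpace K] [MeasurableSpace K] [BorelSpace K] [Nonempty K]
    [TopologicalSpace X] [MeasurableSpace X] [BorelSpace X]
    [TopologicalSpace Y] [PolishSpace Y] [MeasurableSpace Y] [BorelSpace Y]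
    {A : Set X} (hA : MeasureTheory.AnalyticSet A) {φ : A → Y} (hφ : Measurable φ)
    {ψ : K → range φ} (hψ : BaireMeasurable ψ) :
    ∃ C ∈ residual K, ∃ f : K → A, ContinuousOn f C ∧ ∀ x ∈ C, φ (f x) = ψ x := by
  have hAne : Nonempty A := by
    obtain ⟨a, -⟩ := (ψ (Classical.arbitrary K)).2
    exact ⟨a⟩
  obtain ⟨h, hh, hhr⟩ : ∃ h : (ℕ → ℕ) → A, Continuous h ∧ Function.Surjective h := by
    rw [MeasureTheory.AnalyticSet] at hA
    rcases hA with rfl | ⟨h, hh, rfl⟩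
    · exact absurd hAne (by simp)
    · exact ⟨rangeFactorization h, hh.subtype_mk _, rangeFactorization_surjective⟩
  obtain ⟨C₁, hC₁, hψc⟩ := hψ.exists_continuousOn
  obtain ⟨C₀, hC₀₁, hG, hd⟩ := mem_residual.1 hC₁
  have hC₀ : C₀ ∈ residual K := residual_of_dense_Gδ hG hd
  have hψ₀ : Continuous fun x : C₀ => (ψ x : Y) :=
    continuous_subtype_val.comp (hψc.mono hC₀₁).domRestrict
  have : StandardBorelSpace C₀ := hG.measurableSet.standardBorel
  -- the graph of the multivalued lift, with the values in `A` coded by points of Baire space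
  let Q : Set (C₀ × (ℕ → ℕ)) := {q | φ (h q.2) = ψ q.1}
  have hQ : MeasurableSet Q := measurableSet_eq_fun
    ((hφ.comp hh.measurable).comp measurable_snd) (hψ₀.measurable.comp measurable_fst)
  have hQ' := hQ.analyticSet_image (f := fun q : C₀ × (ℕ → ℕ) => ((q.1 : K), q.2))
    ((measurable_subtype_coe.comp measurable_fst).prodMk measurable_snd)
  have hQx : ∀ x ∈ C₀, ∃ z, (x, z) ∈ (fun q : C₀ × (ℕ → ℕ) => ((q.1 : K), q.2)) '' Q := by
    intro x hx
    obtain ⟨a, ha⟩ := (ψ x).2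
    obtain ⟨z, rfl⟩ := hhr a
    exact ⟨z, (⟨x, hx⟩, z), ha, rfl⟩
  rw [MeasureTheory.AnalyticSet] at hQ'
  rcases hQ' with h0 | ⟨q, hq, hqr⟩
  · obtain ⟨x, hx⟩ := hd.nonempty
    obtain ⟨z, hz⟩ := hQx x hx
    exact absurd hz (by rw [h0]; exact notMem_empty _)
  have hres : range (fun z => (q z).1) ∈ residual K := by
    refine mem_of_superset hC₀ fun x hx => ?_
    obtain ⟨z, hz⟩ := hQx x hx
    rw [← hqr] at hz
    obtain ⟨w, hw⟩ := hz
    exact ⟨w, congrArg Prod.fst hw⟩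
  obtain ⟨C, hC, t, ht, hsec⟩ := exists_continuousOn_section _ (continuous_fst.comp hq) hres
  refine ⟨C, hC, fun x => h (q (t x)).2,
    (hh.comp (continuous_snd.comp hq)).comp_continuousOn ht, fun x hx => ?_⟩
  obtain ⟨⟨y, z⟩, hyz, hy⟩ : q (t x) ∈ (fun q : C₀ × (ℕ → ℕ) => ((q.1 : K), q.2)) '' Q :=
    hqr ▸ mem_range_self _
  have h1 : (y : K) = x := by
    rw [← hsec x hx]; exact congrArg Prod.fst hy
  have h2 : (q (t x)).2 = z := (congrArg Prod.snd hy).symm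
  subst h1
  simp only [h2]
  exact hyz

/-! ### Agreement and finite modifications in `(2^ℕ)^ℕ` -/

/-- `x` and `y` agree on the first `N` bits of their first `N` coordinates. -/
def AgreeBelow (N : ℕ) (x y : CantorSeq) : Prop := ∀ i < N, ∀ j < N, x i j = y i j

/-- `x` and `y` agree in all coordinates from `m` on. -/
def TailEq (m : ℕ) (x y : CantorSeq) : Prop := ∀ i, m ≤ i → x i = y i

theorem AgreeBelow.mono {N N' : ℕ} {x y : CantorSeq} (h : AgreeBelow N' x y) (hN : N ≤ N') :
    AgreeBelow N x y := fun i hi j hj => h i (hi.trans_le hN) j (hj.trans_le hN)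

theorem AgreeBelow.symm {N : ℕ} {x y : CantorSeq} (h : AgreeBelow N x y) : AgreeBelow N y x :=
  fun i hi j hj => (h i hi j hj).symm

theorem AgreeBelow.trans {N : ℕ} {x y z : CantorSeq} (h : AgreeBelow N x y)
    (h' : AgreeBelow N y z) : AgreeBelow N x z :=
  fun i hi j hj => (h i hi j hj).trans (h' i hi j hj)

theorem isOpen_setOf_agreeBelow (N : ℕ) (x : CantorSeq) : IsOpen {y | AgreeBelow N x y} := by
  have : {y | AgreeBelow N x y} =
      ⋂ i ∈ Iio N, ⋂ j ∈ Iio N, (fun y : CantorSeq => y i j) ⁻¹' {x i j} := by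
    ext y
    simp [AgreeBelow, eq_comm]
  rw [this]
  exact (finite_Iio N).isOpen_biInter fun i _ => (finite_Iio N).isOpen_biInter fun j _ =>
    (isOpen_discrete _).preimage (continuous_apply_apply i j)

theorem exists_agreeBelow_subset {U : Set CantorSeq} (hU : IsOpen U) {x : CantorSeq} (hx : x ∈ U) :
    ∃ N, ∀ y, AgreeBelow N x y → y ∈ U := by
  by_contra! h
  choose y hy hyU using h
  have hlim : Tendsto y atTop (𝓝 x) := by
    refine tendsto_pi_nhds.2 fun i => tendsto_pi_nhds.2 fun j => ?_
    refine tendsto_nhds_of_eventually_eq ?_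
    filter_upwards [eventually_gt_atTop (max i j)] with N hN
    exact (hy N i (lt_of_le_of_lt (le_max_left _ _) hN) j
      (lt_of_le_of_lt (le_max_right _ _) hN)).symm
  exact hU.isClosed_compl.mem_of_tendsto hlim (Eventually.of_forall hyU) hx

theorem isClosed_setOf_tailEq (m : ℕ) (y : CantorSeq) : IsClosed {x | TailEq m x y} := by
  simp only [TailEq, ofPred_forall]
  exact isClosed_iInter fun i => isClosed_iInter fun _ =>
    isClosed_eq (continuous_apply i) continuous_const

/-- The homeomorphism of `(2^ℕ)^ℕ` changing the bits at the finitely many positions in `S`. -/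
def flipBits (S : Finset (ℕ × ℕ)) (x : CantorSeq) : CantorSeq :=
  fun i j => xor (x i j) (decide ((i, j) ∈ S))

theorem continuous_flipBits (S : Finset (ℕ × ℕ)) : Continuous (flipBits S) :=
  continuous_pi fun i => continuous_pi fun j =>
    (continuous_of_discreteTopology (f := fun b : Bool => xor b (decide ((i, j) ∈ S)))).comp
      (continuous_apply_apply i j)

theorem flipBits_flipBits (S T : Finset (ℕ × ℕ)) (x : CantorSeq) :
    flipBits S (flipBits T x) = flipBits (symmDiff S T) x := by
  ext i j
  by_cases h1 : (i, j) ∈ S <;> by_cases h2 : (i, j) ∈ T <;>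
    simp [flipBits, Finset.mem_symmDiff, h1, h2]

theorem isOpenMap_flipBits (S : Finset (ℕ × ℕ)) : IsOpenMap (flipBits S) := by
  have h : ∀ x, flipBits S (flipBits S x) = x := fun x => by
    rw [flipBits_flipBits, symmDiff_self]; ext i j; simp [flipBits]
  exact IsOpenMap.of_inverse (continuous_flipBits S) h h

theorem tailEq_flipBits {S : Finset (ℕ × ℕ)} {m : ℕ} (hS : ∀ p ∈ S, p.1 < m) (x : CantorSeq) :
    TailEq m (flipBits S x) x := by
  intro i hi
  ext j
  have : (i, j) ∉ S := fun h => not_lt_of_ge hi (hS _ h)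
  simp [flipBits, this]

/-- Every comeager set contains a comeager `Gδ` set which is invariant under changing finitely
many bits. -/
theorem exists_isGδ_flipBits_invariant {R : Set CantorSeq} (hR : R ∈ residual CantorSeq) :
    ∃ D ⊆ R, IsGδ D ∧ D ∈ residual CantorSeq ∧ ∀ S, ∀ x ∈ D, flipBits S x ∈ D := by
  obtain ⟨G, hGR, hG, hd⟩ := mem_residual.1 hR
  refine ⟨⋂ S : Finset (ℕ × ℕ), flipBits S ⁻¹' G, fun x hx => hGR ?_,
    IsGδ.iInter fun S => hG.preimage (continuous_flipBits S), ?_, fun S x hx => ?_⟩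
  · have h := mem_iInter.1 hx ∅
    have : flipBits ∅ x = x := by ext i j; simp [flipBits]
    rwa [mem_preimage, this] at h
  · exact countable_iInter_mem.2 fun S => tendsto_residual_of_isOpenMap (continuous_flipBits S)
      (isOpenMap_flipBits S) (residual_of_dense_Gδ hG hd)
  · refine mem_iInter.2 fun T => ?_
    rw [mem_preimage, flipBits_flipBits]
    exact mem_iInter.1 hx _

/-! ### Values of a reduction on tail-equal points -/

/-- Let `f` be continuous on an invariant comeager set `D`, with all fibers contained in
`𝔼₁`-classes. Then in some box, and for all large `m`, any two points which are equal from `m` on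
can be approximated by two such points of `D` with different values.

Otherwise the open sets in which `f` is, on `D`, invariant under flipping bits in the first `k`
coordinates have dense union for every `k`. By the Baire category theorem in a fiber of `f`, that
fiber consists locally of points which are equal from some `k` on, although flipping a late bit of
coordinate `k` does not leave the fiber. -/
theorem exists_box_forall_exists_ne {Z : Type*} [TopologicalSpace Z] [T2Space Z]
    {f : CantorSeq → Z} {D : Set CantorSeq} (hD : D ∈ residual CantorSeq)
    (hinv : ∀ S, ∀ x ∈ D, flipBits S x ∈ D) (hf : ContinuousOn f D)
    (hfib : ∀ x ∈ D, ∀ y ∈ D, f x = f y → EOne x y) :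
    ∃ (v : CantorSeq) (k : ℕ), ∀ m ≥ k, ∀ a b, AgreeBelow k v a → AgreeBelow k v b →
      TailEq m a b → ∀ N, ∃ c ∈ D, ∃ d ∈ D,
        AgreeBelow N a c ∧ AgreeBelow N b d ∧ TailEq m c d ∧ f c ≠ f d := by
  by_contra! h
  -- flipping bits in coordinates below `k` within `U` does not change the values of `f` on `D`
  let Flat : ℕ → Set CantorSeq → Prop := fun k U => ∀ a ∈ U, a ∈ D → ∀ S : Finset (ℕ × ℕ),
    (∀ p ∈ S, p.1 < k) → flipBits S a ∈ U → f (flipBits S a) = f a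
  let O : ℕ → Set CantorSeq := fun k => ⋃₀ {U | IsOpen U ∧ Flat k U}
  have hO : ∀ k, IsOpen (O k) := fun k => isOpen_sUnion fun U hU => hU.1
  have hOd : ∀ k, Dense (O k) := by
    intro k
    refine dense_iff_inter_open.2 fun U hU ⟨x, hx⟩ => ?_
    obtain ⟨N, hN⟩ := exists_agreeBelow_subset hU hx
    obtain ⟨m, hm, a, b, ha, hb, hab, N', hN'⟩ := h x (max k N)
    refine ⟨a, hN a (ha.mono (le_max_right _ _)), {y | AgreeBelow N' a y},
      ⟨isOpen_setOf_agreeBelow _ _, ?_⟩, fun _ _ _ _ => rfl⟩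
    intro c hc hcD S hS hSc
    -- `flipBits T` maps the box around `a` onto the box around `b`
    let T := (Finset.range m ×ˢ Finset.range N').filter fun p => a p.1 p.2 ≠ b p.1 p.2
    have hT : TailEq m (flipBits T c) c := tailEq_flipBits (fun p hp => by
      simp only [T, Finset.mem_filter, Finset.mem_product, Finset.mem_range] at hp
      exact hp.1.1) c
    have hTb : AgreeBelow N' b (flipBits T c) := by
      intro i hi j hj
      have h1 : c i j = a i j := (hc i hi j hj).symm
      by_cases him : i < m
      · by_cases h2 : a i j = b i j
        · simp [flipBits, T, h1, h2]
        · simp only [flipBits, T, h1, Finset.mem_filter, Finset.mem_product, Finset.mem_range,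
            him, hj, h2, ne_eq, not_false_eq_true, and_self, decide_true]
          revert h2
          cases a i j <;> cases b i j <;> simp
      · simp [flipBits, T, him, h1, congrFun (hab i (not_lt.1 him)) j]
    have hSm : TailEq m (flipBits S c) c := tailEq_flipBits (fun p hp =>
      (hS p hp).trans_le ((le_max_left _ _).trans hm)) c
    have h1 := hN' c hcD _ (hinv T c hcD) hc hTb fun i hi => (hT i hi).symm
    have h2 := hN' _ (hinv S c hcD) _ (hinv T c hcD) hSc hTb
      fun i hi => (hSm i hi).trans (hT i hi).symm
    exact h2.trans h1.symm
  have hR : D ∩ ⋂ k, O k ∈ residual CantorSeq :=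
    inter_mem hD (countable_iInter_mem.2 fun k => residual_of_dense_open (hO k) (hOd k))
  obtain ⟨D', hD'R, hG, hD', hinv'⟩ := exists_isGδ_flipBits_invariant hR
  obtain ⟨b, hb⟩ := (dense_of_mem_residual hD').nonempty
  have hD'D : D' ⊆ D := fun x hx => (hD'R hx).1
  -- a fiber of `f` is a `Gδ` set, covered by the closed sets `{x | TailEq k x b}`
  let Φ : Set CantorSeq := D' ∩ f ⁻¹' {f b}
  have hΦ : IsGδ Φ := by
    obtain ⟨u, hu, hfu⟩ := continuousOn_iff_isClosed.1 (hf.mono hD'D) {f b} isClosed_singleton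
    have : Φ = u ∩ D' := by rw [← hfu, inter_comm]
    rw [this]
    exact hu.isGδ.inter hG
  have : BaireSpace Φ := hΦ.baireSpace_of_t2Space_locallyCompactSpace
  have : Nonempty Φ := ⟨⟨b, hb, rfl⟩⟩
  obtain ⟨k, ⟨⟨a, haD, hab⟩, hint⟩⟩ := nonempty_interior_of_iUnion_of_closed
    (f := fun k => {x : Φ | TailEq k x b})
    (fun k => (isClosed_setOf_tailEq k b).preimage continuous_subtype_val)
    (eq_univ_of_forall fun x => mem_iUnion.2
      (hfib _ (hD'D x.2.1) _ (hD'D hb) x.2.2))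
  obtain ⟨_, hsub, ⟨W, hW, rfl⟩, haW⟩ := mem_interior.1 hint
  obtain ⟨U, ⟨hU, hflat⟩, haU⟩ := mem_iInter.1 (hD'R haD).2 (k + 1)
  obtain ⟨N, hN⟩ := exists_agreeBelow_subset (hW.inter hU) ⟨haW, haU⟩
  -- flipping the bit `N` of coordinate `k` stays in the fiber but destroys equality with `b` at `k`
  let S : Finset (ℕ × ℕ) := {(k, N)}
  have hSa : AgreeBelow N a (flipBits S a) := by
    intro i hi j hj
    simp [flipBits, S, hj.ne]
  have hfS : f (flipBits S a) = f a :=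
    hflat a haU (hD'D haD) S (by simp [S]) (hN _ hSa).2
  have h1 : TailEq k (flipBits S a) b :=
    @hsub ⟨flipBits S a, hinv' S a haD, hfS.trans hab⟩ (hN _ hSa).1
  have h2 : TailEq k a b := @hsub ⟨a, haD, hab⟩ haW
  have h3 := congrFun ((h1 k le_rfl).trans (h2 k le_rfl).symm) N
  simp [flipBits, S] at h3

/-! ### Fusion -/

/-- `x` and `y` agree on the first `M` bits of their coordinates with index in `[i - k, M)`. -/
def AgreeFrom (k M i : ℕ) (x y : CantorSeq) : Prop :=
  ∀ i', i ≤ i' + k → i' < M → ∀ j < M, x i' j = y i' j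

theorem AgreeFrom.symm {k M i : ℕ} {x y : CantorSeq} (h : AgreeFrom k M i x y) :
    AgreeFrom k M i y x := fun i' h1 h2 j hj => (h i' h1 h2 j hj).symm

theorem AgreeFrom.trans {k M i : ℕ} {x y z : CantorSeq} (h : AgreeFrom k M i x y)
    (h' : AgreeFrom k M i y z) : AgreeFrom k M i x z :=
  fun i' h1 h2 j hj => (h i' h1 h2 j hj).trans (h' i' h1 h2 j hj)

theorem AgreeFrom.mono {k M i i₁ : ℕ} {x y : CantorSeq} (h : AgreeFrom k M i x y) (hi : i ≤ i₁) :
    AgreeFrom k M i₁ x y := fun i' h1 h2 j hj => h i' (hi.trans h1) h2 j hj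

/-- The `i`th coordinate of `u x` depends only on the first `M` bits of the coordinates of `x` with
index in `[i - k, M)`. -/
def IsTailMap (k M : ℕ) (u : CantorSeq → CantorSeq) : Prop :=
  ∀ x y i, AgreeFrom k M i x y → u x i = u y i

/-- Pairs of points of the box `{y | AgreeBelow k v y}` which are equal from some `m ≥ k` on can be
approximated by pairs in `W` which are equal from `m` on. -/
def TailDense (v : CantorSeq) (k : ℕ) (W : Set (CantorSeq × CantorSeq)) : Prop :=
  ∀ m ≥ k, ∀ a b, AgreeBelow k v a → AgreeBelow k v b → TailEq m a b →
    ∀ N, ∃ c d, (c, d) ∈ W ∧ AgreeBelow N a c ∧ AgreeBelow N b d ∧ TailEq m c d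

/-- A tail map, regarded as an approximation up to `N`, can be extended so as to send a given pair
of points, distinguished by their first `M` bits, into a tail-dense open set. -/
theorem exists_extension_pair {v : CantorSeq} {k M N : ℕ} {W : Set (CantorSeq × CantorSeq)}
    (hWo : IsOpen W) (hW : TailDense v k W) {u : CantorSeq → CantorSeq}
    (hu : IsTailMap k M u) (huv : ∀ x, AgreeBelow k v (u x)) {x y : CantorSeq}
    (hxy : ¬ AgreeBelow M x y) :
    ∃ N' ≥ N, ∃ u', IsTailMap k M u' ∧ (∀ z, AgreeBelow N (u z) (u' z)) ∧
      ∀ a b, AgreeBelow N' (u' x) a → AgreeBelow N' (u' y) b → (a, b) ∈ W := by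
  classical
  -- tail maps are forced to have equal values at `x` and `y` exactly in the coordinates from `m` on
  have hex : ∃ i, AgreeFrom k M i x y := ⟨M + k, fun i' h1 h2 => by omega⟩
  obtain ⟨m, hm, hmin⟩ : ∃ m, AgreeFrom k M m x y ∧ ∀ i, AgreeFrom k M i x y → m ≤ i :=
    ⟨Nat.find hex, Nat.find_spec hex, fun i hi => Nat.find_min' hex hi⟩
  have hkm : k ≤ m := by
    by_contra hlt
    exact hxy fun i hi j hj => hm i (by omega) hi j hj
  obtain ⟨c, d, hcd, hc, hd, htail⟩ := hW m hkm (u x) (u y) (huv x) (huv y)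
    (fun i hi => hu x y i (hm.mono hi)) N
  let u' : CantorSeq → CantorSeq := fun z i =>
    if AgreeFrom k M i z x then c i else if AgreeFrom k M i z y then d i else u z i
  have hx : u' x = c := by
    ext1 i
    exact if_pos fun _ _ _ _ _ => rfl
  have hy : u' y = d := by
    ext1 i
    by_cases h : AgreeFrom k M i y x
    · exact (if_pos h).trans (htail i (hmin i h.symm))
    · exact (if_neg h).trans (if_pos fun _ _ _ _ _ => rfl)
  obtain ⟨A, B, hA, hB, hcA, hdB, hAB⟩ := isOpen_prod_iff.1 hWo c d hcd
  obtain ⟨N₁, hN₁⟩ := exists_agreeBelow_subset hA hcA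
  obtain ⟨N₂, hN₂⟩ := exists_agreeBelow_subset hB hdB
  refine ⟨max N (max N₁ N₂), le_max_left _ _, u', ?_, ?_, ?_⟩
  · intro z w i hzw
    have h1 : ∀ t, AgreeFrom k M i z t ↔ AgreeFrom k M i w t :=
      fun t => ⟨hzw.symm.trans, hzw.trans⟩
    simp only [u', h1, hu z w i hzw]
  · intro z i hi j hj
    by_cases h1 : AgreeFrom k M i z x
    · simp only [u', if_pos h1, hu z x i h1]
      exact hc i hi j hj
    by_cases h2 : AgreeFrom k M i z y
    · simp only [u', if_neg h1, if_pos h2, hu z y i h2]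
      exact hd i hi j hj
    · simp only [u', if_neg h1, if_neg h2]
  · intro a b ha hb
    rw [hx] at ha
    rw [hy] at hb
    exact hAB ⟨hN₁ a (ha.mono ((le_max_left _ _).trans (le_max_right _ _))),
      hN₂ b (hb.mono ((le_max_right _ _).trans (le_max_right _ _)))⟩

theorem exists_extension_finset {v : CantorSeq} {k M N : ℕ} {W : Set (CantorSeq × CantorSeq)}
    (hWo : IsOpen W) (hW : TailDense v k W) (hN : k ≤ N) {u : CantorSeq → CantorSeq}
    (hu : IsTailMap k M u) (huv : ∀ x, AgreeBelow k v (u x))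
    (P : Finset (CantorSeq × CantorSeq)) :
    ∃ N' ≥ N, ∃ u', IsTailMap k M u' ∧ (∀ z, AgreeBelow N (u z) (u' z)) ∧
      ∀ p ∈ P, ¬ AgreeBelow M p.1 p.2 →
        ∀ a b, AgreeBelow N' (u' p.1) a → AgreeBelow N' (u' p.2) b → (a, b) ∈ W := by
  classical
  induction P using Finset.induction_on with
  | empty => exact ⟨N, le_rfl, u, hu, fun _ _ _ _ _ => rfl, by simp⟩
  | insert p P _ ih =>
    obtain ⟨N₁, hN₁, u₁, hu₁, hext₁, hP₁⟩ := ih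
    by_cases hp : AgreeBelow M p.1 p.2
    · refine ⟨N₁, hN₁, u₁, hu₁, hext₁, fun q hq hne => ?_⟩
      rcases Finset.mem_insert.1 hq with rfl | hq
      · exact absurd hp hne
      · exact hP₁ q hq hne
    obtain ⟨N₂, hN₂, u₂, hu₂, hext₂, hp₂⟩ := exists_extension_pair hWo hW hu₁
      (fun x => (huv x).trans ((hext₁ x).mono hN)) hp
    refine ⟨N₂, hN₁.trans hN₂, u₂, hu₂, fun z => (hext₁ z).trans ((hext₂ z).mono hN₁),
      fun q hq hne a b ha hb => ?_⟩
    rcases Finset.mem_insert.1 hq with rfl | hq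
    · exact hp₂ a b ha hb
    · exact hP₁ q hq hne a b ((hext₂ _).trans (ha.mono hN₂)) ((hext₂ _).trans (hb.mono hN₂))

/-- The point obtained from `x` by replacing all but the first `M` bits of the first `M`
coordinates by `false`. -/
def truncate (M : ℕ) (x : CantorSeq) : CantorSeq := fun i j => decide (i < M ∧ j < M) && x i j

theorem agreeBelow_truncate (M : ℕ) (x : CantorSeq) : AgreeBelow M x (truncate M x) := by
  intro i hi j hj
  simp [truncate, hi, hj]

theorem finite_range_truncate (M : ℕ) : (range (truncate M)).Finite := by
  let e : (Fin M → Fin M → Bool) → CantorSeq := fun w i j =>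
    if h : i < M ∧ j < M then w ⟨i, h.1⟩ ⟨j, h.2⟩ else false
  refine (finite_range e).subset ?_
  rintro _ ⟨x, rfl⟩
  refine ⟨fun i j => x i j, ?_⟩
  ext i j
  by_cases h : i < M ∧ j < M <;> simp [e, truncate, h]

theorem IsTailMap.apply_truncate {k M : ℕ} {u : CantorSeq → CantorSeq} (hu : IsTailMap k M u)
    (x : CantorSeq) : u (truncate M x) = u x := by
  ext1 i
  exact hu _ _ _ fun i' _ h j hj => (agreeBelow_truncate M x i' h j hj).symm

/-- All pairs of points distinguished by their first `M` bits can be treated at once. -/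
theorem exists_extension_forall {v : CantorSeq} {k M N : ℕ} {W : Set (CantorSeq × CantorSeq)}
    (hWo : IsOpen W) (hW : TailDense v k W) (hN : k ≤ N) {u : CantorSeq → CantorSeq}
    (hu : IsTailMap k M u) (huv : ∀ x, AgreeBelow k v (u x)) :
    ∃ N' ≥ N, ∃ u', IsTailMap k M u' ∧ (∀ z, AgreeBelow N (u z) (u' z)) ∧
      ∀ x y, ¬ AgreeBelow M x y →
        ∀ a b, AgreeBelow N' (u' x) a → AgreeBelow N' (u' y) b → (a, b) ∈ W := by
  obtain ⟨N', hN', u', hu', hext, hP⟩ := exists_extension_finset hWo hW hN hu huv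
    ((finite_range_truncate M).toFinset ×ˢ (finite_range_truncate M).toFinset)
  refine ⟨N', hN', u', hu', hext, fun x y hxy a b ha hb => ?_⟩
  refine hP (truncate M x, truncate M y) (by simp) (fun h => hxy ?_) a b ?_ ?_
  · exact ((agreeBelow_truncate M x).trans h).trans (agreeBelow_truncate M y).symm
  · rwa [hu'.apply_truncate]
  · rwa [hu'.apply_truncate]

/-- A tail map can be extended so as to record the first `M + 1` bits of each of the first `M + 1`
coordinates of its argument; those of coordinate `i` are recorded in coordinate `i + k`. -/
theorem exists_extension_record {k M : ℕ} (N : ℕ) {u : CantorSeq → CantorSeq}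
    (hu : IsTailMap k M u) :
    ∃ N' > N, ∃ u', IsTailMap k (M + 1) u' ∧ (∀ z, AgreeBelow N (u z) (u' z)) ∧
      ∀ x a, AgreeBelow N' (u' x) a → ∀ i ≤ M, ∀ j ≤ M, a (i + k) (N + j) = x i j := by
  let u' : CantorSeq → CantorSeq := fun x i j =>
    if i < N ∧ j < N then u x i j
    else if k ≤ i ∧ i - k < M + 1 ∧ j - N < M + 1 then x (i - k) (j - N) else false
  refine ⟨N + k + M + 1, by omega, u', ?_, ?_, ?_⟩
  · intro x y i h
    ext j
    have h1 : u x i = u y i := hu x y i fun i' h1 h2 j hj => h i' h1 (by omega) j (by omega)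
    by_cases h2 : k ≤ i ∧ i - k < M + 1 ∧ j - N < M + 1
    · simp only [u', h1, h (i - k) (by omega) h2.2.1 (j - N) h2.2.2]
    · simp only [u', h1, h2, if_false]
  · intro z i hi j hj
    simp [u', hi, hj]
  · intro x a ha i hi j hj
    rw [← ha (i + k) (by omega) (N + j) (by omega)]
    have h1 : ¬ (i + k < N ∧ N + j < N) := by omega
    have h2 : k ≤ i + k ∧ i < M + 1 ∧ j < M + 1 := by omega
    simp only [u', if_neg h1, Nat.add_sub_cancel, Nat.add_sub_cancel_left]
    exact if_pos h2

/-- Given countably many tail-dense open sets of pairs, there is a continuous reduction of `𝔼₁` to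
itself which sends every pair of distinct points into all but finitely many of them. -/
theorem exists_continuous_reduction_forall_mem {v : CantorSeq} {k : ℕ}
    {W : ℕ → Set (CantorSeq × CantorSeq)} (hWo : ∀ s, IsOpen (W s))
    (hW : ∀ s, TailDense v k (W s)) :
    ∃ g : CantorSeq → CantorSeq, Continuous g ∧ IsReduction EOne EOne g ∧
      ∀ x y, x ≠ y → ∀ᶠ s in atTop, (g x, g y) ∈ W s := by
  let Good : ℕ → ℕ × (CantorSeq → CantorSeq) → Prop := fun s p =>
    k ≤ p.1 ∧ IsTailMap k s p.2 ∧ ∀ x, AgreeBelow k v (p.2 x)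
  have step : ∀ s (p : {p // Good s p}), ∃ q : {q // Good (s + 1) q},
      p.1.1 < q.1.1 ∧ (∀ x, AgreeBelow p.1.1 (p.1.2 x) (q.1.2 x)) ∧
      (∀ x y, ¬ AgreeBelow (s + 1) x y → ∀ a b,
        AgreeBelow q.1.1 (q.1.2 x) a → AgreeBelow q.1.1 (q.1.2 y) b → (a, b) ∈ W s) ∧
      ∃ n, ∀ x a, AgreeBelow q.1.1 (q.1.2 x) a → ∀ i ≤ s, ∀ j ≤ s, a (i + k) (n + j) = x i j := by
    rintro s ⟨⟨N, u⟩, hN, hu, huv⟩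
    obtain ⟨N₁, hN₁, u₁, hu₁, hext₁, hrec⟩ := exists_extension_record N hu
    have huv₁ : ∀ x, AgreeBelow k v (u₁ x) := fun x => (huv x).trans ((hext₁ x).mono hN)
    have hkN₁ : k ≤ N₁ := le_trans hN hN₁.le
    obtain ⟨N₂, hN₂, u₂, hu₂, hext₂, hpair⟩ :=
      exists_extension_forall (hWo s) (hW s) hkN₁ hu₁ huv₁
    exact ⟨⟨(N₂, u₂), hkN₁.trans hN₂, hu₂, fun x => (huv₁ x).trans ((hext₂ x).mono hkN₁)⟩,
      lt_of_lt_of_le hN₁ hN₂, fun x => (hext₁ x).trans ((hext₂ x).mono hN₁.le), hpair, N,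
      fun x a ha => hrec x a ((hext₂ x).trans (ha.mono hN₂))⟩
  choose next hlt hext hpair hrec using step
  let p : ∀ s, {p // Good s p} := fun s =>
    Nat.rec ⟨(k, fun _ => v), le_rfl, fun _ _ _ _ => rfl, fun _ _ _ _ _ => rfl⟩ next s
  let N : ℕ → ℕ := fun s => (p s).1.1
  let u : ℕ → CantorSeq → CantorSeq := fun s => (p s).1.2
  have hu : ∀ s, IsTailMap k s (u s) := fun s => (p s).2.2.1
  have hNmono : StrictMono N := strictMono_nat_of_lt_succ fun s => hlt s (p s)
  have hchain : ∀ s t, s ≤ t → ∀ x, AgreeBelow (N s) (u s x) (u t x) := by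
    intro s t hst x
    induction t, hst using Nat.le_induction with
    | base => exact fun _ _ _ _ => rfl
    | succ t hst ih => exact ih.trans ((hext t (p t) x).mono (hNmono.monotone hst))
  -- bit `j` of coordinate `i` is settled at stage `max i j + 1`, because `s ≤ N s`
  let g : CantorSeq → CantorSeq := fun x i j => u (max i j + 1) x i j
  have hg : ∀ s x, AgreeBelow (N s) (u s x) (g x) := by
    intro s x i hi j hj
    have hle : max i j < N (max i j + 1) := hNmono.le_apply
    rcases le_total s (max i j + 1) with h | h
    · exact hchain _ _ h x i hi j hj
    · exact (hchain _ _ h x i ((le_max_left _ _).trans_lt hle) j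
        ((le_max_right _ _).trans_lt hle)).symm
  have hgW : ∀ s x y, ¬ AgreeBelow (s + 1) x y → (g x, g y) ∈ W s := fun s x y h =>
    hpair s (p s) x y h _ _ (hg (s + 1) x) (hg (s + 1) y)
  refine ⟨g, ?_, fun x y => ⟨?_, ?_⟩, fun x y hxy => ?_⟩
  · refine continuous_pi fun i => continuous_pi fun j => ?_
    refine (IsLocallyConstant.iff_eventually_eq _).2 (fun x => ?_) |>.continuous
    filter_upwards [(isOpen_setOf_agreeBelow (max i j + 1) x).mem_nhds fun _ _ _ _ => rfl]
      with y hy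
    exact congrFun (hu _ y x i fun i' _ h j hj => (hy i' h j hj).symm) j
  · rintro ⟨m, hm⟩
    refine ⟨m + k, fun i hi => ?_⟩
    ext j
    exact congrFun (hu (max i j + 1) x y i fun i' h _ j _ => congrFun (hm i' (by omega)) j) j
  · rintro ⟨m, hm⟩
    refine ⟨m, fun i hi => ?_⟩
    ext j
    obtain ⟨n, hn⟩ := hrec (max i j) (p (max i j))
    rw [← hn x (g x) (hg (max i j + 1) x) i (le_max_left _ _) j (le_max_right _ _),
      ← hn y (g y) (hg (max i j + 1) y) i (le_max_left _ _) j (le_max_right _ _),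
      hm (i + k) (by omega)]
  · obtain ⟨i, hi⟩ := Function.ne_iff.1 hxy
    obtain ⟨j, hj⟩ := Function.ne_iff.1 hi
    filter_upwards [eventually_ge_atTop (max i j)] with s hs
    exact hgW s x y fun h => hj (h i (by omega) j (by omega))

/-- A map which on a comeager set is continuous and a reduction of `𝔼₁` yields a continuous
embedding of `𝔼₁`. -/
theorem eOneEmbedsContinuously_of_continuousOn {Z : Type*} [TopologicalSpace Z] [T2Space Z]
    {E : Setoid Z} {C : Set CantorSeq} (hC : C ∈ residual CantorSeq) {f : CantorSeq → Z}
    (hf : ContinuousOn f C) (hred : ∀ x ∈ C, ∀ y ∈ C, EOne x y ↔ E (f x) (f y)) :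
    EOneEmbedsContinuously E := by
  obtain ⟨D, hDC, hG, hD, hinv⟩ := exists_isGδ_flipBits_invariant hC
  obtain ⟨U, hU, rfl⟩ := isGδ_iff_eq_iInter_nat.1 hG
  obtain ⟨v, k, hvk⟩ := exists_box_forall_exists_ne hD hinv (hf.mono hDC) fun x hx y hy h =>
    (hred x (hDC hx) y (hDC hy)).2 (h ▸ E.refl _)
  -- pairs with neighborhoods whose points in `D = ⋂ n, U n` are separated by `f`; the sets `U r`,
  -- `r ≤ s`, are added to bring the range of `g` into `D`
  let W₀ : Set (CantorSeq × CantorSeq) := ⋃₀ {O | IsOpen O ∧ ∀ p ∈ O,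
    p.1 ∈ ⋂ n, U n → p.2 ∈ ⋂ n, U n → f p.1 ≠ f p.2}
  let W : ℕ → Set (CantorSeq × CantorSeq) := fun s =>
    W₀ ∩ (⋂ r ∈ Iic s, U r) ×ˢ (⋂ r ∈ Iic s, U r)
  have hUo : ∀ s, IsOpen (⋂ r ∈ Iic s, U r) := fun s =>
    (finite_Iic s).isOpen_biInter fun r _ => hU r
  have hWo : ∀ s, IsOpen (W s) := fun s =>
    (isOpen_sUnion fun O hO => hO.1).inter ((hUo s).prod (hUo s))
  have hmem : ∀ s, ∀ c ∈ ⋂ n, U n, c ∈ ⋂ r ∈ Iic s, U r := fun s c hc =>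
    mem_iInter₂.2 fun r _ => mem_iInter.1 hc r
  obtain ⟨g, hg, hgred, hgW⟩ := exists_continuous_reduction_forall_mem hWo (v := v) (k := k) <| by
    intro s m hm a b ha hb hab N
    obtain ⟨c, hc, d, hd, hac, hbd, hcd, hne⟩ := hvk m hm a b ha hb hab N
    refine ⟨c, d, ⟨?_, hmem s c hc, hmem s d hd⟩, hac, hbd, hcd⟩
    obtain ⟨A, B, hA, hB, hcA, hdB, hAB⟩ := t2_separation hne
    obtain ⟨A', hA', hAA'⟩ := (continuousOn_iff'.1 (hf.mono hDC)) A hA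
    obtain ⟨B', hB', hBB'⟩ := (continuousOn_iff'.1 (hf.mono hDC)) B hB
    refine ⟨A' ×ˢ B', ⟨hA'.prod hB', ?_⟩, ?_⟩
    · rintro ⟨x, y⟩ ⟨hx, hy⟩ hxD hyD hxy
      have h1 : x ∈ f ⁻¹' A ∩ ⋂ n, U n := hAA' ▸ ⟨hx, hxD⟩
      have h2 : y ∈ f ⁻¹' B ∩ ⋂ n, U n := hBB' ▸ ⟨hy, hyD⟩
      exact hAB.ne_of_mem h1.1 h2.1 hxy
    · have h1 : c ∈ A' ∩ ⋂ n, U n := hAA' ▸ ⟨hcA, hc⟩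
      have h2 : d ∈ B' ∩ ⋂ n, U n := hBB' ▸ ⟨hdB, hd⟩
      exact ⟨h1.1, h2.1⟩
  have hgD : ∀ x, g x ∈ ⋂ n, U n := by
    intro x
    obtain ⟨y, hy⟩ := exists_ne x
    refine mem_iInter.2 fun r => ?_
    obtain ⟨s, hs, hrs⟩ := ((hgW x y hy.symm).and (eventually_ge_atTop r)).exists
    exact mem_iInter₂.1 hs.2.1 r hrs
  refine ⟨f ∘ g, (hf.mono hDC).comp_continuous hg hgD, fun x y hxy => ?_, fun x y => ?_⟩
  · by_contra hne
    obtain ⟨s, ⟨O, ⟨-, hO⟩, hxyO⟩, -⟩ := (hgW x y hne).exists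
    exact hO _ hxyO (hgD x) (hgD y) hxy
  · exact (hgred x y).trans (hred _ (hDC (hgD x)) _ (hDC (hgD y)))

/-! ### Closure under Borel reducibility -/

/-- A Baire measurable reduction of `𝔼₁` into the range of a Borel reduction defined on an
analytic set pulls back to a continuous embedding of `𝔼₁`. -/
theorem eOneEmbedsContinuously_of_baireMeasurable {X : Type u} {Y : Type v}
    [TopologicalSpace X] [T2Space X] [MeasurableSpace X] [BorelSpace X]
    [TopologicalSpace Y] [PolishSpace Y] [MeasurableSpace Y] [BorelSpace Y]
    {E : Setoid X} {F : Setoid Y} {A : Set X} (hA : MeasureTheory.AnalyticSet A) {φ : A → Y}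
    (hφ : Measurable φ) (hφr : IsReduction (restrict E A) F φ) {ψ : CantorSeq → range φ}
    (hψ : BaireMeasurable ψ) (hψr : IsReduction EOne (restrict F (range φ)) ψ) :
    EOneEmbedsContinuously (restrict E A) := by
  have : PolishSpace CantorSeq := {}
  obtain ⟨C, hC, f, hf, hφf⟩ := exists_continuousOn_lift hA hφ hψ
  refine eOneEmbedsContinuously_of_continuousOn hC hf fun x hx y hy => ?_
  rw [hψr x y, hφr, hφf x hx, hφf y hy]
  rfl

theorem determinedClass_of_borelReducible (𝓔 : Set BorelEqRel.{w}) {E : BorelEqRel.{u}}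
    {F : BorelEqRel.{v}} (h : BorelReducible E.rel F.rel) (hF : F ∈ determinedClass 𝓔) :
    E ∈ determinedClass 𝓔 := by
  obtain ⟨g, hg, hgr⟩ := h
  intro A hA
  let φ : A → F.carrier := fun a => g a
  have hφ : Measurable φ := hg.comp measurable_subtype_coe
  have hφr : IsReduction (restrict E.rel A) F.rel φ := fun x y => hgr x y
  have hrange : MeasureTheory.AnalyticSet (range φ) := by
    obtain ⟨β, _, _, c, hc, rfl⟩ := MeasureTheory.analyticSet_iff_exists_polishSpace_range.1 hA
    borelize β
    have h := MeasurableSet.univ.analyticSet_image (hg.comp hc.measurable)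
    rwa [image_univ, range_comp, ← Subtype.range_val (s := range c), ← range_comp] at h
  rcases hF _ hrange with ⟨R, hR, θ, hθ, hθr⟩ | ⟨ψ, hψ, -, hψr⟩
  · exact Or.inl ⟨R, hR, fun a => θ (rangeFactorization φ a), hθ.comp (hφ.subtype_mk),
      fun x y => (hφr x y).trans (hθr (rangeFactorization φ x) (rangeFactorization φ y))⟩
  · exact Or.inr (eOneEmbedsContinuously_of_baireMeasurable hA hφ hφr
      (fun V hV => (hV.preimage hψ).baireMeasurableSet) hψr)

end EOneClosure

theorem mainTheorem9 :
    (∀ (X : Type u) (Y : Type v)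
        [TopologicalSpace X] [PolishSpace X] [MeasurableSpace X] [BorelSpace X]
        [TopologicalSpace Y] [PolishSpace Y] [MeasurableSpace Y] [BorelSpace Y]
        (E : Setoid X) (F : Setoid Y),
        EOneClosure.IsBorelRel E → EOneClosure.IsBorelRel F →
        ∀ A : Set X, MeasureTheory.AnalyticSet A →
        ∀ φ : A → Y, Measurable φ →
          EOneClosure.IsReduction (EOneClosure.restrict E A) F φ →
        ∀ ψ : EOneClosure.CantorSeq → Set.range φ, EOneClosure.BaireMeasurable ψ →
          EOneClosure.IsReduction EOneClosure.EOne
            (EOneClosure.restrict F (Set.range φ)) ψ →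
        EOneClosure.EOneEmbedsContinuously (EOneClosure.restrict E A)) ∧
    (∀ (𝓔 : Set EOneClosure.BorelEqRel.{w})
        (E : EOneClosure.BorelEqRel.{u}) (F : EOneClosure.BorelEqRel.{v}),
        EOneClosure.BorelReducible E.rel F.rel →
        F ∈ EOneClosure.determinedClass 𝓔 →
        E ∈ EOneClosure.determinedClass 𝓔) ∧
    (∀ (E : EOneClosure.BorelEqRel.{u}) (F : EOneClosure.BorelEqRel.{v}),
        EOneClosure.BorelReducible E.rel F.rel →
        F ∈ EOneClosure.determinedClass EOneClosure.countableClass.{w} →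
        E ∈ EOneClosure.determinedClass EOneClosure.countableClass.{w}) :=
  ⟨fun _ _ _ _ _ _ _ _ _ _ _ _ _ _ _ hA _ hφ hφr _ hψ hψr =>
      EOneClosure.eOneEmbedsContinuously_of_baireMeasurable hA hφ hφr hψ hψr,
    fun 𝓔 _ _ h hF => EOneClosure.determinedClass_of_borelReducible 𝓔 h hF,
    fun _ _ h hF => EOneClosure.determinedClass_of_borelReducible _ h hF⟩
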